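/- Let $\mathscr H,\mathscr K$ be complex Hilbert spaces and let $\Phi:\mathbb B(\mathscr H)\to\mathbb B(\mathscr K)$ be a positive linear map with $\Phi(I_{\mathscr H})=I_{\mathscr K}$, where $\mathbb B(\cdot)$ denotes the algebra of bounded linear operators. Let $A,B\in\mathbb B(\mathscr H)$ be positive invertible contractions (that is, positive invertible operators with $\|A\|\le 1$ and $\|B\|\le 1$), and let $0\le\lambda\le 1$. For bounded operators $X,Y$ on the same Hilbert space write $X\nabla_\lambda Y=(1-\lambda)X+\lambda Y$, and let $\log$ of a positive invertible operator be defined by the continuous functional calculus. Then $\Phi(A)\nabla_\lambda\Phi(B)$ is positive and invertible (so that its logarithm is defined), and $$\log\big(\Phi(A)\nabla_\lambda\Phi(B)\big)\ \ge\ \Phi(\log A)\nabla_\lambda\Phi(\log B)$$ in the usual order on self-adjoint operators ($S\ge T$ if and only if $S-T$ is a positive operator). -/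

import Mathlib

/-- The weighted arithmetic mean `A ∇_t B = (1 - t) A + t B` of two bounded operators. -/
noncomputable def arithMean {H : Type*} [NormedAddCommGroup H] [InnerProductSpace ℂ H]
    (t : ℝ) (A B : H →L[ℂ] H) : H →L[ℂ] H :=
  (1 - t) • A + t • B

open Filter Topology Polynomial

section UnitalPositiveMap

variable {A B : Type*} [CStarAlgebra A] [PartialOrder A] [StarOrderedRing A]
  [CStarAlgebra B] [PartialOrder B] [StarOrderedRing B]

/-! Operator concavity of `log` reduces the claim to `Φ(log a) ≤ log Φ(a)`. Since `log a = lim 2^n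
(a^(1/2^n) - 1)`, it suffices to compare dyadic roots, hence by iteration square roots. Those follow
from Kadison's inequality and operator monotonicity of the square root. For Kadison, the images
under `Φ` of the Bernstein polynomials of `a` are positive and sum to `1`. They act as an
operator-valued distribution on `0, …, n` with mean `n Φ(a)`; its variance is nonnegative, and `n →
∞` removes the error. -/

/-- Bernstein polynomials of a positive contraction are positive. -/
lemma aeval_bernsteinPolynomial_nonneg {a : A} (ha : 0 ≤ a) (ha1 : a ≤ 1) (n k : ℕ) :
    0 ≤ aeval a (bernsteinPolynomial ℝ n k) := by
  have hsa : IsSelfAdjoint a := .of_nonneg ha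
  rw [← cfc_polynomial (bernsteinPolynomial ℝ n k) a]
  refine cfc_nonneg fun x hx ↦ ?_
  have h0 : 0 ≤ x := spectrum_nonneg_of_nonneg ha hx
  have h1 : x ≤ 1 := by
    have := (le_algebraMap_iff_spectrum_le (r := (1 : ℝ)) (a := a)).1 (by simpa using ha1)
    exact this x hx
  simp only [bernsteinPolynomial, eval_mul, eval_pow, eval_sub, eval_one, eval_X, eval_natCast]
  have : 0 ≤ 1 - x := by linarith
  positivity

/-- The second moment of the Bernstein polynomials. -/
lemma bernsteinPolynomial_sum_sq_smul (n : ℕ) :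
    ∑ k ∈ Finset.range (n + 1), ((k : ℝ) ^ 2) • bernsteinPolynomial ℝ n k =
      ((n : ℝ) ^ 2 - n) • (X ^ 2 : ℝ[X]) + (n : ℝ) • X := by
  have h1 := bernsteinPolynomial.sum_smul ℝ n
  have h2 := bernsteinPolynomial.sum_mul_smul ℝ n
  have key : ∀ k : ℕ, ((k * (k - 1) + k : ℕ) : ℝ) = (k : ℝ) ^ 2 := by
    intro k
    cases k with
    | zero => simp
    | succ k => push_cast [Nat.add_sub_cancel]; ring
  calc _ = ∑ k ∈ Finset.range (n + 1), ((k * (k - 1)) • bernsteinPolynomial ℝ n k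
            + k • bernsteinPolynomial ℝ n k) := by
        refine Finset.sum_congr rfl fun k _ ↦ ?_
        rw [← key k, ← add_smul, Nat.cast_smul_eq_nsmul]
    _ = (n * (n - 1)) • X ^ 2 + n • X := by rw [Finset.sum_add_distrib, h1, h2]
    _ = _ := by
        rw [show (n : ℝ) ^ 2 - n = ((n * (n - 1) : ℕ) : ℝ) by
          rw [← key n]; push_cast; ring, Nat.cast_smul_eq_nsmul, Nat.cast_smul_eq_nsmul]

/-- Kadison's inequality up to a lower-order error, from Bernstein approximation of degree `n`. -/
lemma sq_map_le_bernstein (Φ : A →ₚ[ℂ] B) (hΦ : Φ 1 = 1) {a : A} (ha : 0 ≤ a) (ha1 : a ≤ 1)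
    (n : ℕ) :
    ((n : ℝ) ^ 2) • (Φ a) ^ 2 ≤ ((n : ℝ) ^ 2 - n) • Φ (a ^ 2) + (n : ℝ) • Φ a := by
  set P : ℕ → B := fun k ↦ Φ (aeval a (bernsteinPolynomial ℝ n k)) with hP
  have hsum (c : ℕ → ℝ) : ∑ k ∈ Finset.range (n + 1), c k • P k =
      Φ (aeval a (∑ k ∈ Finset.range (n + 1), c k • bernsteinPolynomial ℝ n k)) := by
    simp only [hP, map_sum, map_smul, PositiveLinearMap.map_smul_of_tower]
  have h0 : ∑ k ∈ Finset.range (n + 1), P k = 1 := by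
    simpa [bernsteinPolynomial.sum, hΦ] using hsum fun _ ↦ 1
  have h1 : ∑ k ∈ Finset.range (n + 1), (k : ℝ) • P k = (n : ℝ) • Φ a := by
    rw [hsum]
    simp only [Nat.cast_smul_eq_nsmul, bernsteinPolynomial.sum_smul]
    rw [map_nsmul, aeval_X, map_nsmul]
  have h2 : ∑ k ∈ Finset.range (n + 1), ((k : ℝ) ^ 2) • P k =
      ((n : ℝ) ^ 2 - n) • Φ (a ^ 2) + (n : ℝ) • Φ a := by
    rw [hsum, bernsteinPolynomial_sum_sq_smul]
    simp only [map_add, map_smul, aeval_X, map_pow, PositiveLinearMap.map_smul_of_tower]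
  set T := Φ a with hT
  have hTsa : IsSelfAdjoint T := .of_nonneg (Φ.map_nonneg ha)
  -- Variance terms: as `∑ P k = 1` and `∑ k P k = n T`, their sum is the second moment minus `n²
  -- T²`.
  have hterm (k : ℕ) : 0 ≤ ((k : ℝ) • (1 : B) - (n : ℝ) • T) * P k * ((k : ℝ) • 1 - (n : ℝ) • T) :=
    (IsSelfAdjoint.sub (.smul (.all _) (.one _)) (.smul (.all _) hTsa)).conjugate_nonneg
      (Φ.map_nonneg (aeval_bernsteinPolynomial_nonneg ha ha1 n k))
  have hexp (k : ℕ) : ((k : ℝ) • (1 : B) - (n : ℝ) • T) * P k * ((k : ℝ) • 1 - (n : ℝ) • T) =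
      ((k : ℝ) ^ 2) • P k - (n : ℝ) • (T * ((k : ℝ) • P k)) - (n : ℝ) • (((k : ℝ) • P k) * T)
        + ((n : ℝ) ^ 2) • (T * P k * T) := by
    simp only [sub_mul, mul_sub, smul_mul_assoc, mul_smul_comm, one_mul, mul_one]
    module
  have hpos := Finset.sum_nonneg fun k (_ : k ∈ Finset.range (n + 1)) ↦ hterm k
  simp only [hexp, Finset.sum_add_distrib, Finset.sum_sub_distrib, ← Finset.smul_sum,
    ← Finset.mul_sum, ← Finset.sum_mul] at hpos
  rw [h0, h1, h2] at hpos
  rw [← sub_nonneg]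
  convert hpos using 1
  simp only [smul_mul_assoc, mul_smul_comm, mul_one, pow_two T]
  module

/-- **Kadison's inequality** for positive contractions: a unital positive linear map `Φ` satisfies
`Φ(a)² ≤ Φ(a²)`. -/
lemma sq_map_le_map_sq (Φ : A →ₚ[ℂ] B) (hΦ : Φ 1 = 1) {a : A} (ha : 0 ≤ a) (ha1 : a ≤ 1) :
    (Φ a) ^ 2 ≤ Φ (a ^ 2) := by
  have hlim : Tendsto (fun n : ℕ ↦ (1 - (n : ℝ)⁻¹) • Φ (a ^ 2) + (n : ℝ)⁻¹ • Φ a) atTop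
      (𝓝 ((1 - 0 : ℝ) • Φ (a ^ 2) + (0 : ℝ) • Φ a)) := by
    have h : Tendsto (fun n : ℕ ↦ (n : ℝ)⁻¹) atTop (𝓝 0) := tendsto_inv_atTop_nhds_zero_nat
    exact ((tendsto_const_nhds.sub h).smul_const _).add (h.smul_const _)
  rw [sub_zero, one_smul, zero_smul, add_zero] at hlim
  refine ge_of_tendsto hlim ?_
  filter_upwards [eventually_ge_atTop 1] with n hn
  have hn0 : (n : ℝ) ≠ 0 := by positivity
  have h := smul_le_smul_of_nonneg_left (sq_map_le_bernstein Φ hΦ ha ha1 n)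
    (show (0 : ℝ) ≤ ((n : ℝ) ^ 2)⁻¹ by positivity)
  rw [smul_smul, inv_mul_cancel₀ (pow_ne_zero 2 hn0), one_smul] at h
  refine h.trans_eq ?_
  rw [smul_add, smul_smul, smul_smul]
  congr 2 <;> field_simp

/-- A unital positive linear map preserves strict positivity. -/
lemma IsStrictlyPositive.map_positiveLinearMap (Φ : A →ₚ[ℂ] B) (hΦ : Φ 1 = 1) {a : A}
    (ha : IsStrictlyPositive a) : IsStrictlyPositive (Φ a) := by
  cases subsingleton_or_nontrivial A with
  | inl _ => rw [Subsingleton.elim a 1, hΦ]; exact isStrictlyPositive_one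
  | inr _ =>
    -- Compactness of the spectrum gives `a ≥ r > 0`, a bound that `Φ` transports.
    obtain ⟨r, hr, hra⟩ := (CFC.exists_pos_algebraMap_le_iff (a := a) ha.isSelfAdjoint).2
      fun x hx ↦ ha.spectrum_pos hx
    have h : r • (1 : B) ≤ Φ a := by
      have := OrderHomClass.mono Φ hra
      rwa [Algebra.algebraMap_eq_smul_one, PositiveLinearMap.map_smul_of_tower, hΦ] at this
    exact IsStrictlyPositive.of_le (.smul hr isStrictlyPositive_one) h

/-- A unital positive linear map satisfies `Φ(√a) ≤ √Φ(a)` on positive contractions. -/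
lemma map_sqrt_le_sqrt_map (Φ : A →ₚ[ℂ] B) (hΦ : Φ 1 = 1) {a : A} (ha : 0 ≤ a) (ha1 : a ≤ 1) :
    Φ (CFC.sqrt a) ≤ CFC.sqrt (Φ a) := by
  have h := sq_map_le_map_sq Φ hΦ (CFC.sqrt_nonneg a)
    (by simpa using CFC.sqrt_le_sqrt a 1 ha1)
  rw [CFC.sq_sqrt a] at h
  simpa [CFC.sqrt_sq (Φ (CFC.sqrt a)) (Φ.map_nonneg (CFC.sqrt_nonneg a))] using
    CFC.sqrt_le_sqrt _ _ h

/-- A unital positive linear map satisfies `Φ(a ^ (1 / 2 ^ n)) ≤ Φ(a) ^ (1 / 2 ^ n)`. -/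
lemma map_rpow_inv_two_pow_le (Φ : A →ₚ[ℂ] B) (hΦ : Φ 1 = 1) {a : A}
    (ha : IsStrictlyPositive a) (ha1 : a ≤ 1) (n : ℕ) :
    Φ (a ^ ((2 ^ n)⁻¹ : ℝ)) ≤ (Φ a) ^ ((2 ^ n)⁻¹ : ℝ) := by
  induction n with
  | zero =>
    simp [CFC.rpow_one a ha.nonneg, CFC.rpow_one (Φ a) (Φ.map_nonneg ha.nonneg)]
  | succ n ih =>
    have hn : ((2 ^ n)⁻¹ : ℝ) ≠ 0 := by positivity
    have hexp : ((2 ^ (n + 1))⁻¹ : ℝ) = (2 ^ n)⁻¹ / 2 := by rw [pow_succ]; field_simp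
    -- The root is again a contraction, so the square-root inequality applies to it.
    have hle : a ^ ((2 ^ n)⁻¹ : ℝ) ≤ 1 := by
      have := CFC.rpow_le_rpow (p := ((2 ^ n)⁻¹ : ℝ))
        ⟨by positivity, inv_le_one_of_one_le₀ (one_le_pow₀ one_le_two)⟩ ha1
      simpa using this
    rw [hexp, ← CFC.sqrt_rpow ha.isUnit hn,
      ← CFC.sqrt_rpow (ha.map_positiveLinearMap Φ hΦ).isUnit hn]
    exact (map_sqrt_le_sqrt_map Φ hΦ CFC.rpow_nonneg hle).trans (CFC.sqrt_le_sqrt _ _ ih)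

/-- The logarithm as a limit of dyadic difference quotients of powers. -/
lemma tendsto_two_pow_smul_rpow_sub_one {a : A} (ha : IsStrictlyPositive a) :
    Tendsto (fun n : ℕ ↦ (2 ^ n : ℝ) • (a ^ ((2 ^ n)⁻¹ : ℝ) - 1)) atTop (𝓝 (CFC.log a)) := by
  have hseq : Tendsto (fun n : ℕ ↦ ((2 ^ n)⁻¹ : ℝ)) atTop (𝓝[>] 0) :=
    tendsto_inv_atTop_nhdsGT_zero.comp (tendsto_pow_atTop_atTop_of_one_lt one_lt_two)
  refine ((CFC.tendsto_cfc_rpow_sub_one_log ha).comp hseq).congr fun n ↦ ?_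
  simp only [Function.comp, ← smul_eq_mul, inv_inv]
  rw [cfc_smul _ (hf := by fun_prop (disch := grind)),
    cfc_sub _ _ (hf := by fun_prop (disch := grind)),
    cfc_const_one .., CFC.rpow_eq_cfc_real ..]

/-- **Jensen's operator inequality** for the logarithm: a unital positive linear map `Φ` satisfies
`Φ(log a) ≤ log Φ(a)` for positive invertible contractions `a`. -/
lemma map_log_le_log_map (Φ : A →ₚ[ℂ] B) (hΦ : Φ 1 = 1) {a : A}
    (ha : IsStrictlyPositive a) (ha1 : a ≤ 1) : Φ (CFC.log a) ≤ CFC.log (Φ a) := by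
  refine le_of_tendsto_of_tendsto' (((map_continuous Φ).tendsto _).comp
    (tendsto_two_pow_smul_rpow_sub_one ha))
    (tendsto_two_pow_smul_rpow_sub_one (ha.map_positiveLinearMap Φ hΦ)) fun n ↦ ?_
  rw [Function.comp, PositiveLinearMap.map_smul_of_tower, map_sub, hΦ]
  exact smul_le_smul_of_nonneg_left
    (sub_le_sub_right (map_rpow_inv_two_pow_le Φ hΦ ha ha1 n) 1) (by positivity)

end UnitalPositiveMap

theorem mainTheorem3 {H K : Type*}
    [NormedAddCommGroup H] [InnerProductSpace ℂ H] [CompleteSpace H]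
    [NormedAddCommGroup K] [InnerProductSpace ℂ K] [CompleteSpace K]
    (Φ : (H →L[ℂ] H) →ₚ[ℂ] (K →L[ℂ] K)) (hΦ : Φ 1 = 1)
    (A B : H →L[ℂ] H) (hA : IsStrictlyPositive A) (hB : IsStrictlyPositive B)
    (hA_contraction : ‖A‖ ≤ 1) (hB_contraction : ‖B‖ ≤ 1)
    (t : ℝ) (ht : t ∈ Set.Icc (0 : ℝ) 1) :
    IsStrictlyPositive (arithMean t (Φ A) (Φ B)) ∧
      arithMean t (Φ (CFC.log A)) (Φ (CFC.log B)) ≤ CFC.log (arithMean t (Φ A) (Φ B)) := by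
  have hconc := CFC.concaveOn_log (A := K →L[ℂ] K)
  have hΦA := hA.map_positiveLinearMap Φ hΦ
  have hΦB := hB.map_positiveLinearMap Φ hΦ
  have ht' : 0 ≤ 1 - t := sub_nonneg.2 ht.2
  have hsum : 1 - t + t = 1 := by ring
  refine ⟨hconc.1 hΦA hΦB ht' ht.1 hsum, ?_⟩
  refine le_trans ?_ (hconc.2 hΦA hΦB ht' ht.1 hsum)
  exact add_le_add
    (smul_le_smul_of_nonneg_left (map_log_le_log_map Φ hΦ hA
      ((CStarAlgebra.norm_le_one_iff_of_nonneg A hA.nonneg).1 hA_contraction)) ht')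
    (smul_le_smul_of_nonneg_left (map_log_le_log_map Φ hΦ hB
      ((CStarAlgebra.norm_le_one_iff_of_nonneg B hB.nonneg).1 hB_contraction)) ht.1)
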